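/- Notation. Let $\mathbb T=[0,\infty)$, let $\mathbb U$ and $E$ be finite-dimensional Euclidean spaces, let $U:\mathbb T\rightsquigarrow\mathbb U$ be a set-valued map with graph $\mathrm{Gr}\,U=\{(t,u): t\in\mathbb T,\ u\in U(t)\}$, and let $a:\mathbb T\times E\times\mathbb U\to E$. $\mathcal L^1_{loc}$ denotes the functions $\mathbb T\to[0,\infty)$ that are integrable on compact sets. For a finite-dimensional space $F$ and a topological space $S$, a map $b:\mathbb T\times S\times\mathbb U\to F$ is called Carathéodory if $b(\cdot,y,u)$ is Lebesgue measurable on $\mathbb T$ for all $y\in S$, $u\in\bigcup_{t}U(t)$; $(t,u)\mapsto b(t,y,u)$ is (Lebesgue $\otimes$ Borel) measurable on $\mathrm{Gr}\,U$ for each $y$; and $b(t,\cdot,\cdot)$ is continuous on $S\times U(t)$ for each $t\in\mathbb T$. It is integrally bounded if for each compact $K\subset\mathbb T\times S$ there is $M_K\in\mathcal L^1_{loc}$ with $\|b(t,x,u)\|\le M_K(t)$ for all $(t,x)\in K$, $u\in U(t)$. For maps of $(t,u)$ only, $S$ is a point. Assumptions. (u): $U$ has compact values; $\mathrm{Gr}\,U$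 is a Borel subset of $\mathbb T\times\mathbb U$; and for each compact $K\subset\mathbb T$ there is $M\in\mathcal L^1_{loc}$ with $\|u\|\le M(t)$ for all $t\in K$, $u\in U(t)$. (a): $a$ is Carathéodory, integrally bounded, and Lipschitz in the state: for each compact $K\subset\mathbb T\times E$ there is $L_K\in\mathcal L^1_{loc}$ with $\|a(t,x',u)-a(t,x'',u)\|\le L_K(t)\|x'-x''\|$ for all $(t,x'),(t,x'')\in K$, $u\in U(t)$, where moreover (continuability) one function $L=L_K$ can be used for all $K$. Let $u^0$ be an admissible control, that is, a Borel measurable selector of $U$ on $\mathbb T$. A relaxed control is a weakly measurable map $\eta$ from $\mathbb T$ to the Borel probability measures on $\mathbb U$ with $\eta(t)(U(t))=1$ for a.a. $t$; put $\tilde u^0(t)=\delta_{u^0(t)}$. A trajectory $y$ of $\eta$ is a Carathéodory solution on $\mathbb T$ of $\dot y(t)=\int_{U(t)}a(t,y(t),u)\,\eta(t)(du)$ (with any initial value in $E$). For a map $w:\mathbb T\times\mathbb U\to[0,\infty)$ put $\mathfrak L_w[\eta](\tau)=\int_0^\tau\int_{U(t)}w(t,u)\,\eta(t)(du)\,dt$.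 $(Null)(u^0)$ is the set of all integrally bounded Carathéodory maps $w:\mathbb T\times\mathbb U\to[0,\infty)$ such that $\mathfrak L_w[\tilde u^0]\equiv0$ and such that, for every relaxed control $\eta$ that coincides with $\tilde u^0$ a.e. on $[T,\infty)$ for some $T\in\mathbb T$, and for every $\tau\in\mathbb T$, $\mathfrak L_w[\eta](\tau)=0$ implies $\eta=\tilde u^0$ a.e. on $[0,\tau]$. Proposition. Assume (u) and (a), and let $u^0$ be an admissible control. Let $G:\mathbb T\rightsquigarrow E$ be a compact-valued map that is bounded on each compact subset of $\mathbb T$ and has closed graph. Then for every $(\tau^*,y^*)\in\mathbb T\times E$ there is exactly one Carathéodory solution $z$ on $\mathbb T$ of $\dot z(t)=a(t,z(t),u^0(t))$ with $z(\tau^*)=y^*$; denote its initial value $z(0)$ by $\beta(\tau^*,y^*)$. Moreover, there is a weight $w^0\in(Null)(u^0)$ such that for every relaxed control $\eta$, every $T\in\mathbb T$ and every trajectory $y$ of $\eta$ with $y(t)\in G(t)$ for all $t\in[0,T]$, $$\|\beta(\tau,y(\tau))-y(0)\|_E\le\mathfrak L_{w^0}[\eta](\tau)\qquad\text{for all }\tau\in[0,T].$$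 -/

import Mathlib

open MeasureTheory Set
open scoped BoundedContinuousFunction

/-! Time is the half-line `[0, ∞)`, realised as `Set.Ici (0 : ℝ)`; values of functions of time at
negative arguments never matter. `V` is the space of control values, `E` the state space. -/

/-- The graph `{(t, u) | t ≥ 0, u ∈ U t}` of a set-valued map on the half-line. -/
def timeGraph {V : Type*} (U : ℝ → Set V) : Set (ℝ × V) :=
  {p | 0 ≤ p.1 ∧ p.2 ∈ U p.1}

/-- Nonnegative functions on `[0, ∞)` that are integrable on compact subsets of `[0, ∞)`. -/
def IsLocL1 (M : ℝ → ℝ) : Prop :=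
  (∀ t, 0 ≤ t → 0 ≤ M t) ∧ LocallyIntegrableOn M (Ici 0) volume

/-- The condition on the set-valued map `U` of control constraints: compact values, integrable
boundedness on compact sets of times, and Borel graph. -/
structure ConditionU {V : Type*} [NormedAddCommGroup V] [MeasurableSpace V]
    (U : ℝ → Set V) : Prop where
  isCompact : ∀ t, 0 ≤ t → IsCompact (U t)
  bounded : ∀ K : Set ℝ, IsCompact K → K ⊆ Ici 0 →
    ∃ M : ℝ → ℝ, IsLocL1 M ∧ ∀ t ∈ K, ∀ u ∈ U t, ‖u‖ ≤ M t
  measurableSet_graph : MeasurableSet (timeGraph U)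

/-- Carathéodory maps. Here `NullMeasurableSpace ℝ volume` is the real line with the σ-algebra of
Lebesgue measurable sets. The first field is measurability in `t` for fixed state and control
value; the second one is joint measurability in `(t, u)`, on the graph of `U`, for a fixed state
(for non-constant `U` it does not follow from the other two fields, and without it
`t ↦ a t y (u t)` need not be measurable for measurable selectors `u` of `U`). -/
structure IsCaratheodory {S V F : Type*} [TopologicalSpace S] [TopologicalSpace V]
    [MeasurableSpace V] [TopologicalSpace F] [MeasurableSpace F] [Zero F]
    (U : ℝ → Set V) (a : ℝ → S → V → F) : Prop where
  measurable_time : ∀ (y : S) (u : V), (∃ t, (t, u) ∈ timeGraph U) →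
    AEMeasurable (fun t => a t y u) (volume.restrict (Ici 0))
  measurable_graph : ∀ y : S,
    Measurable (fun p : NullMeasurableSpace ℝ volume × V =>
      (timeGraph U).indicator (fun q : ℝ × V => a q.1 y q.2) p)
  continuous : ∀ t, 0 ≤ t → ContinuousOn (fun p : S × V => a t p.1 p.2) (univ ×ˢ U t)

/-- Integrable boundedness on each compact subset of `[0, ∞) × S`. -/
def IsIntegrallyBounded {S V F : Type*} [TopologicalSpace S] [NormedAddCommGroup F]
    (U : ℝ → Set V) (a : ℝ → S → V → F) : Prop :=
  ∀ K : Set (ℝ × S), IsCompact K → K ⊆ Ici 0 ×ˢ univ →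
    ∃ M : ℝ → ℝ, IsLocL1 M ∧ ∀ t x, (t, x) ∈ K → ∀ u ∈ U t, ‖a t x u‖ ≤ M t

/-- Local Lipschitz continuity in the state, uniformly in the control. -/
def IsLocallyLipschitz {E V F : Type*} [NormedAddCommGroup E] [NormedAddCommGroup F]
    (U : ℝ → Set V) (a : ℝ → E → V → F) : Prop :=
  ∀ K : Set (ℝ × E), IsCompact K → K ⊆ Ici 0 ×ˢ univ →
    ∃ L : ℝ → ℝ, IsLocL1 L ∧ ∀ t x x', (t, x) ∈ K → (t, x') ∈ K → ∀ u ∈ U t,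
      ‖a t x u - a t x' u‖ ≤ L t * ‖x - x'‖

/-- The continuability condition: integrable boundedness on compact sets, and Lipschitz continuity
in the state with a Lipschitz function of time that does not depend on the compact set. -/
def IsContinuable {E V F : Type*} [NormedAddCommGroup E] [NormedAddCommGroup F]
    (U : ℝ → Set V) (a : ℝ → E → V → F) : Prop :=
  IsIntegrallyBounded U a ∧
    ∃ L : ℝ → ℝ, IsLocL1 L ∧ ∀ t, 0 ≤ t → ∀ x x' : E, ∀ u ∈ U t,
      ‖a t x u - a t x' u‖ ≤ L t * ‖x - x'‖

/-- The condition on the right-hand side `a` of the control system. -/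
structure ConditionA {E V : Type*} [NormedAddCommGroup E] [MeasurableSpace E]
    [NormedAddCommGroup V] [MeasurableSpace V]
    (U : ℝ → Set V) (a : ℝ → E → V → E) : Prop where
  caratheodory : IsCaratheodory U a
  lipschitz : IsLocallyLipschitz U a
  bounded : IsIntegrallyBounded U a
  continuable : IsContinuable U a

/-- Admissible controls: Borel measurable selectors of `U` on `[0, ∞)`. -/
def IsAdmissibleControl {V : Type*} [MeasurableSpace V] (U : ℝ → Set V) (u : ℝ → V) : Prop :=
  Measurable ((Ici (0 : ℝ)).domRestrict u) ∧ ∀ t, 0 ≤ t → u t ∈ U t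

/-- Generalized (relaxed) controls: weakly measurable families of probability measures on the
space of control values, concentrated on `U t` for almost every `t ≥ 0`. -/
def IsRelaxedControl {V : Type*} [NormedAddCommGroup V] [MeasurableSpace V]
    (U : ℝ → Set V) (η : ℝ → ProbabilityMeasure V) : Prop :=
  (∀ φ : V →ᵇ ℝ, AEMeasurable (fun t => ∫ u, φ u ∂(η t : Measure V)) (volume.restrict (Ici 0))) ∧
    ∀ᵐ t ∂(volume.restrict (Ici (0 : ℝ))), (η t : Measure V) (U t) = 1

/-- `y` is a (Carathéodory) solution of `y' = f t y` on all of `[0, ∞)`. -/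
def IsSolution {E : Type*} [NormedAddCommGroup E] [NormedSpace ℝ E]
    (f : ℝ → E → E) (y : ℝ → E) : Prop :=
  ContinuousOn y (Ici 0) ∧
    LocallyIntegrableOn (fun s => f s (y s)) (Ici 0) volume ∧
    ∀ t, 0 ≤ t → y t = y 0 + ∫ s in (0 : ℝ)..t, f s (y s)

/-- `y` is a trajectory generated by the generalized control `η`. -/
def IsTrajectory {E V : Type*} [NormedAddCommGroup E] [NormedSpace ℝ E] [MeasurableSpace V]
    (U : ℝ → Set V) (a : ℝ → E → V → E) (η : ℝ → ProbabilityMeasure V) (y : ℝ → E) : Prop :=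
  IsSolution (fun t x => ∫ u in U t, a t x u ∂(η t : Measure V)) y

/-- `y` is a solution for the control `u₀` that passes through the position `(τ, x)`. -/
def IsSolutionThrough {E V : Type*} [NormedAddCommGroup E] [NormedSpace ℝ E]
    (a : ℝ → E → V → E) (u₀ : ℝ → V) (τ : ℝ) (x : E) (y : ℝ → E) : Prop :=
  IsSolution (fun t z => a t z (u₀ t)) y ∧ y τ = x

open Classical in
/-- The initial value `y 0` of the solution `y` for `u₀` that passes through `(τ, x)`. -/
noncomputable def begPoint {E V : Type*} [NormedAddCommGroup E] [NormedSpace ℝ E]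
    (a : ℝ → E → V → E) (u₀ : ℝ → V) (τ : ℝ) (x : E) : E :=
  if h : ∃ y, IsSolutionThrough a u₀ τ x y then h.choose 0 else 0

/-- `𝔏_w[η](τ)`, the integral over `[0, τ]` of the `η t`-mean of the weight `w t` over `U t`. -/
noncomputable def weightIntegral {V : Type*} [MeasurableSpace V] (U : ℝ → Set V)
    (w : ℝ → V → ℝ) (η : ℝ → ProbabilityMeasure V) (τ : ℝ) : ℝ :=
  ∫ t in (0 : ℝ)..τ, ∫ u in U t, w t u ∂(η t : Measure V)

/-- Generalized controls that coincide with (the Dirac control of) `u₀` from some time on. -/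
def IsFin {V : Type*} [NormedAddCommGroup V] [MeasurableSpace V] [BorelSpace V]
    (U : ℝ → Set V) (u₀ : ℝ → V) (η : ℝ → ProbabilityMeasure V) : Prop :=
  IsRelaxedControl U η ∧
    ∃ T : ℝ, 0 ≤ T ∧ ∀ᵐ t ∂(volume.restrict (Ici T)), η t = diracProba (u₀ t)

/-- The weights `w` that vanish exactly along `u₀`. A weight depends on time and control only; it
is viewed as a map with a one-point state space. -/
structure IsNullWeight {V : Type*} [NormedAddCommGroup V] [MeasurableSpace V] [BorelSpace V]
    (U : ℝ → Set V) (u₀ : ℝ → V) (w : ℝ → V → ℝ) : Prop where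
  nonneg : ∀ t, 0 ≤ t → ∀ u, 0 ≤ w t u
  caratheodory : IsCaratheodory U (fun t (_ : Unit) u => w t u)
  bounded : IsIntegrallyBounded U (fun t (_ : Unit) u => w t u)
  null : ∀ τ, 0 ≤ τ → weightIntegral U w (fun t => diracProba (u₀ t)) τ = 0
  separating : ∀ η, IsFin U u₀ η → ∀ τ, 0 ≤ τ → weightIntegral U w η τ = 0 →
    ∀ᵐ t ∂(volume.restrict (Icc 0 τ)), η t = diracProba (u₀ t)

/-! Let `L` be the global Lipschitz function, Λ(t) = ∫₀ᵗ L, and let ρ be a measurable, locally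
bounded radius with G(t) in the ball of radius ρ(t). The weight is w(t,u) = exp(Λ(t)) · max over ‖x‖
≤ ρ(t) of ‖a(t,x,u) − a(t,x,u₀(t))‖ + ‖u − u₀(t)‖ on U(t), and 0 elsewhere.

If z solves the equation for u₀ with z(τ) = y(τ), then ‖z − y‖ at time t is at most the integral
over [t,τ] of L‖z − y‖ plus the η-mean of the maximum. Backward Grönwall
(`le_integral_exp_mul_of_le_integral`) produces exactly the factor exp(Λ), so at time 0 the bound is
𝔏_w[η](τ); this is `norm_sub_le_weightIntegral`.

The summand ‖u − u₀(t)‖ is not needed for the estimate. It makes w vanish on U(t) only at u₀(t), so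
a vanishing mean forces a Dirac measure (`isNullWeight_deviationWeight`).

Global existence comes from a contraction in an exponentially weighted sup norm, and uniqueness from
a two-sided Grönwall argument with the same exponential. -/

/-! ### Exponentials of primitives and Grönwall inequalities. -/

theorem LipschitzOnWith.comp_absolutelyContinuousOnInterval {f g : ℝ → ℝ} {K : NNReal} {s : Set ℝ}
    {a b : ℝ} (hg : LipschitzOnWith K g s) (hf : AbsolutelyContinuousOnInterval f a b)
    (hs : MapsTo f (uIcc a b) s) : AbsolutelyContinuousOnInterval (fun t => g (f t)) a b := by
  rw [absolutelyContinuousOnInterval_iff] at hf ⊢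
  intro ε hε
  obtain ⟨δ, hδ, h⟩ := hf (ε / (K + 1)) (by positivity)
  refine ⟨δ, hδ, fun I hI hlt => ?_⟩
  have h1 := h I hI hlt
  rw [lt_div_iff₀ (by positivity)] at h1
  refine lt_of_le_of_lt ?_ h1
  rw [Finset.sum_mul]
  refine Finset.sum_le_sum fun i hi => ?_
  have hmem : ∀ i ∈ Finset.range I.1, (I.2 i).1 ∈ uIcc a b ∧ (I.2 i).2 ∈ uIcc a b := hI.1
  have h2 := hg.dist_le_mul _ (hs (hmem i hi).1) _ (hs (hmem i hi).2)
  nlinarith [dist_nonneg (x := f (I.2 i).1) (y := f (I.2 i).2)]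

theorem AbsolutelyContinuousOnInterval.exp {f : ℝ → ℝ} {a b : ℝ}
    (hf : AbsolutelyContinuousOnInterval f a b) :
    AbsolutelyContinuousOnInterval (fun t => Real.exp (f t)) a b := by
  obtain ⟨C, hC⟩ := hf.exists_bound
  obtain ⟨K, hK⟩ := (Real.contDiff_exp (n := 1)).contDiffOn.exists_lipschitzOnWith (s := Icc (-C) C)
    (by decide) (convex_Icc _ _) isCompact_Icc
  exact hK.comp_absolutelyContinuousOnInterval hf fun t ht => abs_le.1 (hC t ht)

theorem MeasureTheory.LocallyIntegrable.intervalIntegrable {F : Type*} [NormedAddCommGroup F]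
    {L : ℝ → F} (hL : LocallyIntegrable L volume) {a b : ℝ} : IntervalIntegrable L volume a b :=
  intervalIntegrable_iff.2 ((hL.integrableOn_isCompact isCompact_uIcc).mono_set uIoc_subset_uIcc)

theorem MeasureTheory.LocallyIntegrable.absolutelyContinuousOnInterval_integral {L : ℝ → ℝ}
    (hL : LocallyIntegrable L volume) (τ a b : ℝ) :
    AbsolutelyContinuousOnInterval (fun t => ∫ s in τ..t, L s) a b := by
  have h : ∀ p q, IntervalIntegrable L volume p q := fun p q => hL.intervalIntegrable
  have h1 := ((h (min τ (min a b)) (max τ (max a b))).absolutelyContinuousOnInterval_intervalIntegral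
    (c := τ) (by simp))
  exact h1.mono (by
    rw [uIcc_subset_uIcc_iff_mem, mem_uIcc, mem_uIcc]
    simp)

theorem MeasureTheory.LocallyIntegrable.continuous_integral {F : Type*} [NormedAddCommGroup F]
    [NormedSpace ℝ F] {L : ℝ → F}
    (hL : LocallyIntegrable L volume) (τ : ℝ) : Continuous (fun t => ∫ s in τ..t, L s) :=
  intervalIntegral.continuous_primitive (fun _ _ => hL.intervalIntegrable) τ

/-- Since `L` is only integrable, the chain rule holds merely almost everywhere; absolute continuity
of the exponential supplies the fundamental theorem of calculus. -/
theorem integral_mul_exp_integral {L : ℝ → ℝ} (hL : LocallyIntegrable L volume) (c τ a b : ℝ) :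
    ∫ t in a..b, c * L t * Real.exp (c * ∫ s in τ..t, L s) =
      Real.exp (c * ∫ s in τ..b, L s) - Real.exp (c * ∫ s in τ..a, L s) := by
  have hac := ((hL.absolutelyContinuousOnInterval_integral τ a b).const_mul c).exp
  rw [← hac.integral_deriv_eq_sub]
  refine intervalIntegral.integral_congr_ae ?_
  filter_upwards [LocallyIntegrable.ae_hasDerivAt_integral hL] with t ht _
  rw [((ht τ).const_mul c).exp.deriv]
  ring

/-- The exponent 2 is there to gain the factor 1/2, which serves both as contraction constant for
existence and as absorption constant for uniqueness. The absolute values treat times before and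
after `τ` alike. -/
theorem abs_integral_mul_exp_abs_integral_le {L : ℝ → ℝ} (hL : LocallyIntegrable L volume)
    (hL0 : ∀ t, 0 ≤ L t) (τ t : ℝ) :
    |∫ s in τ..t, L s * Real.exp (2 * |∫ r in τ..s, L r|)| ≤
      Real.exp (2 * |∫ s in τ..t, L s|) / 2 := by
  rcases le_total τ t with h | h
  · have hpos : ∀ s, τ ≤ s → |∫ r in τ..s, L r| = ∫ r in τ..s, L r := fun s hs =>
      abs_of_nonneg (intervalIntegral.integral_nonneg hs fun r _ => hL0 r)
    have h1 := integral_mul_exp_integral hL 2 τ τ t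
    simp only [mul_assoc, intervalIntegral.integral_const_mul, intervalIntegral.integral_same,
      mul_zero, Real.exp_zero] at h1
    have h2 : ∫ s in τ..t, L s * Real.exp (2 * |∫ r in τ..s, L r|) =
        ∫ s in τ..t, L s * Real.exp (2 * ∫ r in τ..s, L r) := by
      refine intervalIntegral.integral_congr fun s hs => ?_
      rw [uIcc_of_le h] at hs
      simp only [hpos s hs.1]
    rw [abs_of_nonneg (intervalIntegral.integral_nonneg h fun r _ =>
      mul_nonneg (hL0 r) (Real.exp_pos _).le), h2, hpos t h]
    linarith
  · have hneg : ∀ s, s ≤ τ → |∫ r in τ..s, L r| = - ∫ r in τ..s, L r := fun s hs => by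
      rw [intervalIntegral.integral_symm, abs_neg, neg_neg]
      exact abs_of_nonneg (intervalIntegral.integral_nonneg hs fun r _ => hL0 r)
    have h1 := integral_mul_exp_integral hL (-2) τ t τ
    simp only [mul_assoc, intervalIntegral.integral_const_mul, intervalIntegral.integral_same,
      mul_zero, Real.exp_zero] at h1
    have h2 : ∫ s in t..τ, L s * Real.exp (2 * |∫ r in τ..s, L r|) =
        ∫ s in t..τ, L s * Real.exp (-2 * ∫ r in τ..s, L r) := by
      refine intervalIntegral.integral_congr fun s hs => ?_
      rw [uIcc_of_le h] at hs
      simp only [hneg s hs.2]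
      ring_nf
    rw [intervalIntegral.integral_symm, abs_neg,
      abs_of_nonneg (intervalIntegral.integral_nonneg h fun r _ =>
      mul_nonneg (hL0 r) (Real.exp_pos _).le), h2, hneg t h, mul_neg, ← neg_mul]
    linarith

/-- Backward Grönwall inequality with an integrable coefficient. -/
theorem le_integral_exp_mul_of_le_integral {L h φ : ℝ → ℝ} {T : ℝ} (hT : 0 ≤ T)
    (hL : LocallyIntegrable L volume) (hL0 : ∀ t, 0 ≤ L t) (hφ : ContinuousOn φ (Icc 0 T))
    (hh : IntervalIntegrable h volume 0 T)
    (hle : ∀ t ∈ Icc 0 T, φ t ≤ ∫ s in t..T, (L s * φ s + h s)) :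
    φ 0 ≤ ∫ t in (0 : ℝ)..T, Real.exp (∫ s in (0 : ℝ)..t, L s) * h t := by
  have hφ' : ContinuousOn φ (uIcc 0 T) := by rwa [uIcc_of_le hT]
  have hg : IntervalIntegrable (fun s => L s * φ s + h s) volume 0 T :=
    ((hL.intervalIntegrable).mul_continuousOn hφ').add hh
  -- The hypothesis says φ ≤ −ψ. Hence (exp(Λ) ψ)' = exp(Λ)(L(ψ + φ) + h) ≤ exp(Λ) h almost
  -- everywhere, and integration over [0, T] with ψ(T) = 0 bounds −ψ(0) ≥ φ(0).
  set ψ : ℝ → ℝ := fun t => ∫ s in T..t, (L s * φ s + h s) with hψ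
  have hψac : AbsolutelyContinuousOnInterval ψ 0 T :=
    hg.absolutelyContinuousOnInterval_intervalIntegral (by simp)
  have hEac : AbsolutelyContinuousOnInterval (fun t => Real.exp (∫ s in (0 : ℝ)..t, L s)) 0 T :=
    (hL.absolutelyContinuousOnInterval_integral 0 0 T).exp
  have h1 := hEac.integral_deriv_mul_eq_sub hψac
  have hi1 : IntervalIntegrable (fun x => deriv (fun t => Real.exp (∫ s in (0 : ℝ)..t, L s)) x * ψ x
      + Real.exp (∫ s in (0 : ℝ)..x, L s) * deriv ψ x) volume 0 T :=
    (hEac.intervalIntegrable_deriv.mul_continuousOn hψac.continuousOn).add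
      (hψac.intervalIntegrable_deriv.continuousOn_mul hEac.continuousOn)
  have hi2 : IntervalIntegrable (fun t => Real.exp (∫ s in (0 : ℝ)..t, L s) * h t) volume 0 T :=
    hh.continuousOn_mul hEac.continuousOn
  have h2 := intervalIntegral.integral_mono_ae_restrict hT hi1 hi2 (by
    rw [Filter.EventuallyLE, ae_restrict_iff' measurableSet_Icc]
    filter_upwards [LocallyIntegrable.ae_hasDerivAt_integral hL, hg.ae_hasDerivAt_integral] with t ht ht' htT
    have htT' : t ∈ uIcc 0 T := by rwa [uIcc_of_le hT]
    rw [(ht 0).exp.deriv, (ht' htT' T (by simp)).deriv]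
    have h3 : φ t ≤ - ψ t := by
      rw [hψ]; simp only; rw [← intervalIntegral.integral_symm]; exact hle t htT
    have := mul_nonneg (mul_nonneg (Real.exp_pos (∫ s in (0 : ℝ)..t, L s)).le (hL0 t))
      (sub_nonneg.2 h3)
    nlinarith)
  rw [h1] at h2
  have h3 : φ 0 ≤ - ψ 0 := by
    rw [hψ]; simp only; rw [← intervalIntegral.integral_symm]; exact hle 0 ⟨le_rfl, hT⟩
  simp only [intervalIntegral.integral_same, Real.exp_zero, one_mul] at h2
  have h4 : ψ T = 0 := by simp [hψ]
  rw [h4] at h2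
  linarith

/-- Let r maximise exp(−2|Λ|) φ, where Λ is the primitive of `L` from `τ`. Inserting the maximum `m`
into the integral inequality at r gives φ(r) ≤ φ(r)/2, so `m` vanishes. -/
theorem le_zero_of_le_abs_integral_mul {L φ : ℝ → ℝ} {a b τ : ℝ} (hτ : τ ∈ Icc a b)
    (hL : LocallyIntegrable L volume) (hL0 : ∀ t, 0 ≤ L t) (hφ : ContinuousOn φ (Icc a b))
    (hle : ∀ t ∈ Icc a b, φ t ≤ |∫ s in τ..t, L s * φ s|) (hφ0 : ∀ t ∈ Icc a b, 0 ≤ φ t) :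
    ∀ t ∈ Icc a b, φ t ≤ 0 := by
  have hΛ : Continuous fun t => 2 * |∫ s in τ..t, L s| :=
    continuous_const.mul (hL.continuous_integral τ).abs
  obtain ⟨r, hr, hmax⟩ := isCompact_Icc.exists_isMaxOn ⟨τ, hτ⟩
    ((Real.continuous_exp.comp hΛ.neg).continuousOn.mul hφ)
  set m := Real.exp (-(2 * |∫ s in τ..r, L s|)) * φ r with hm
  have hb : ∀ t ∈ Icc a b, φ t ≤ Real.exp (2 * |∫ s in τ..t, L s|) * m := fun t ht => by
    have h1 : Real.exp (-(2 * |∫ s in τ..t, L s|)) * φ t ≤ m := hmax ht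
    rw [Real.exp_neg, inv_mul_le_iff₀ (Real.exp_pos _)] at h1
    exact h1
  have hm0 : 0 ≤ m := mul_nonneg (Real.exp_pos _).le (hφ0 r hr)
  have h1 : |∫ s in τ..r, L s * φ s| ≤
      |∫ s in τ..r, (L s * Real.exp (2 * |∫ q in τ..s, L q|)) * m| := by
    refine intervalIntegral.norm_integral_le_abs_of_norm_le (f := fun s => L s * φ s) ?_ ?_
    · refine (ae_restrict_iff' measurableSet_uIoc).2 (Filter.Eventually.of_forall fun s hs => ?_)
      have hs' : s ∈ Icc a b := (uIcc_subset_Icc hτ hr) (uIoc_subset_uIcc hs)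
      rw [Real.norm_eq_abs, abs_of_nonneg (mul_nonneg (hL0 s) (hφ0 s hs')), mul_assoc]
      exact mul_le_mul_of_nonneg_left (hb s hs') (hL0 s)
    · exact ((hL.intervalIntegrable).mul_continuousOn
        (Real.continuous_exp.comp hΛ).continuousOn).mul_const m
  rw [intervalIntegral.integral_mul_const, abs_mul, abs_of_nonneg hm0] at h1
  have h2 := abs_integral_mul_exp_abs_integral_le hL hL0 τ r
  have h3 : Real.exp (2 * |∫ s in τ..r, L s|) * m = φ r := by
    rw [hm, ← mul_assoc, ← Real.exp_add]; simp
  have h4 := hle r hr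
  have h5 := mul_le_mul_of_nonneg_right h2 hm0
  have h6 : φ r ≤ 0 := by nlinarith
  have h7 : m = 0 := le_antisymm (mul_nonpos_of_nonneg_of_nonpos (Real.exp_pos _).le h6) hm0
  intro t ht
  simpa [h7] using hb t ht

/-! ### Global existence for Lipschitz Carathéodory equations. -/

theorem locallyIntegrable_comp_of_lipschitz {E : Type*} [NormedAddCommGroup E] {f : ℝ → E → E} {L : ℝ → ℝ}
    (hL : LocallyIntegrable L volume)
    (hLip : ∀ t x x', ‖f t x - f t x'‖ ≤ L t * ‖x - x'‖) (hf0 : ∀ t, ‖f t 0‖ ≤ L t)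
    {y : ℝ → E} (hy : Continuous y)
    (hmeas : AEStronglyMeasurable (fun s => f s (y s)) volume) :
    LocallyIntegrable (fun s => f s (y s)) volume := by
  have h1 : LocallyIntegrable (fun s => L s * (1 + ‖y s‖)) volume := by
    have := hL.locallyIntegrableOn univ
    rw [← locallyIntegrableOn_univ]
    exact this.mul_continuousOn (continuous_const.add hy.norm).continuousOn isClosed_univ.isLocallyClosed
  refine h1.mono hmeas (Filter.Eventually.of_forall fun s => ?_)
  refine le_trans ?_ (le_abs_self _)
  have h2 := hLip s (y s) 0
  rw [sub_zero] at h2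
  have h3 := norm_sub_norm_le (f s (y s)) (f s 0)
  linarith [hf0 s]

/-- Writing y = e • v with the weight e = exp(2|Λ|) turns the weighted sup norm of y into the plain
sup norm of a bounded continuous v. In this norm the Picard map is a 1/2-contraction on the whole
line, so no gluing of local solutions is needed. -/
theorem exists_global_solution_of_lipschitz {E : Type*} [NormedAddCommGroup E]
    [NormedSpace ℝ E] [CompleteSpace E] {f : ℝ → E → E} {L : ℝ → ℝ}
    (hL : LocallyIntegrable L volume)
    (hLip : ∀ t x x', ‖f t x - f t x'‖ ≤ L t * ‖x - x'‖) (hf0 : ∀ t, ‖f t 0‖ ≤ L t)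
    (hmeas : ∀ y : ℝ → E, Continuous y → AEStronglyMeasurable (fun s => f s (y s)) volume)
    (τ : ℝ) (x : E) :
    ∃ y : ℝ → E, Continuous y ∧ ∀ t, y t = x + ∫ s in τ..t, f s (y s) := by
  have hL0 : ∀ t, 0 ≤ L t := fun t => (norm_nonneg _).trans (hf0 t)
  set e : ℝ → ℝ := fun t => Real.exp (2 * |∫ s in τ..t, L s|) with he
  have hec : Continuous e :=
    Real.continuous_exp.comp (continuous_const.mul (hL.continuous_integral τ).abs)
  have he1 : ∀ t, 1 ≤ e t := fun t => Real.one_le_exp (by positivity)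
  have he0 : ∀ t, 0 < e t := fun t => Real.exp_pos _
  have hLe : ∀ p q, IntervalIntegrable (fun s => L s * e s) volume p q := fun p q =>
    hL.intervalIntegrable.mul_continuousOn hec.continuousOn
  have hkey : ∀ t, |∫ s in τ..t, L s * e s| ≤ e t / 2 :=
    abs_integral_mul_exp_abs_integral_le hL hL0 τ
  have hcont : ∀ v : ℝ →ᵇ E, Continuous fun s => e s • v s := fun v => hec.smul v.continuous
  have hint : ∀ v : ℝ →ᵇ E, LocallyIntegrable (fun s => f s (e s • v s)) volume := fun v =>
    locallyIntegrable_comp_of_lipschitz hL hLip hf0 (hcont v) (hmeas _ (hcont v))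
  have hbd : ∀ (v : ℝ →ᵇ E) t, ‖(e t)⁻¹ • (x + ∫ s in τ..t, f s (e s • v s))‖ ≤
      ‖x‖ + (1 + ‖v‖) / 2 := by
    intro v t
    have h1 : ‖∫ s in τ..t, f s (e s • v s)‖ ≤ |∫ s in τ..t, (L s * e s) * (1 + ‖v‖)| := by
      refine intervalIntegral.norm_integral_le_abs_of_norm_le
        (Filter.Eventually.of_forall fun s => ?_) ((hLe _ _).mul_const _)
      have h2 := hLip s (e s • v s) 0
      rw [sub_zero, norm_smul, Real.norm_eq_abs, abs_of_pos (he0 s)] at h2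
      have h3 := norm_sub_norm_le (f s (e s • v s)) (f s 0)
      have h4 : L s * (e s * ‖v s‖) ≤ L s * (e s * ‖v‖) :=
        mul_le_mul_of_nonneg_left (mul_le_mul_of_nonneg_left (v.norm_coe_le_norm s) (he0 s).le)
          (hL0 s)
      have h5 : L s * 1 ≤ L s * e s := mul_le_mul_of_nonneg_left (he1 s) (hL0 s)
      linarith [hf0 s]
    rw [intervalIntegral.integral_mul_const, abs_mul, abs_of_nonneg
      (show 0 ≤ 1 + ‖v‖ by positivity)] at h1
    have h2 := mul_le_mul_of_nonneg_right (hkey t) (show 0 ≤ 1 + ‖v‖ by positivity)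
    rw [norm_smul, norm_inv, Real.norm_eq_abs, abs_of_pos (he0 t), inv_mul_le_iff₀ (he0 t)]
    have h3 := norm_add_le x (∫ s in τ..t, f s (e s • v s))
    have h4 := mul_le_mul_of_nonneg_right (he1 t) (norm_nonneg x)
    linarith
  let S : (ℝ →ᵇ E) → (ℝ →ᵇ E) := fun v => BoundedContinuousFunction.ofNormedAddCommGroup
    (fun t => (e t)⁻¹ • (x + ∫ s in τ..t, f s (e s • v s)))
    ((hec.inv₀ fun t => (he0 t).ne').smul
      (continuous_const.add ((hint v).continuous_integral τ))) _ (hbd v)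
  have hS : ContractingWith (1 / 2) S := by
    refine ⟨by norm_num, LipschitzWith.of_dist_le_mul fun v w => ?_⟩
    refine (BoundedContinuousFunction.dist_le (by positivity)).2 fun t => ?_
    change dist ((e t)⁻¹ • (x + ∫ s in τ..t, f s (e s • v s)))
      ((e t)⁻¹ • (x + ∫ s in τ..t, f s (e s • w s))) ≤ _
    rw [dist_eq_norm, ← smul_sub, add_sub_add_left_eq_sub, ← intervalIntegral.integral_sub
      (hint v).intervalIntegrable (hint w).intervalIntegrable, norm_smul, norm_inv,
      Real.norm_eq_abs, abs_of_pos (he0 t), inv_mul_le_iff₀ (he0 t)]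
    have h1 : ‖∫ s in τ..t, (f s (e s • v s) - f s (e s • w s))‖ ≤
        |∫ s in τ..t, (L s * e s) * dist v w| := by
      refine intervalIntegral.norm_integral_le_abs_of_norm_le
        (Filter.Eventually.of_forall fun s => ?_) ((hLe _ _).mul_const _)
      refine (hLip s _ _).trans ?_
      rw [← smul_sub, norm_smul, Real.norm_eq_abs, abs_of_pos (he0 s), ← mul_assoc]
      refine mul_le_mul_of_nonneg_left ?_ (mul_nonneg (hL0 s) (he0 s).le)
      rw [← dist_eq_norm]
      exact BoundedContinuousFunction.dist_coe_le_dist s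
    rw [intervalIntegral.integral_mul_const, abs_mul, abs_of_nonneg (dist_nonneg (x := v))] at h1
    have h2 := mul_le_mul_of_nonneg_right (hkey t) (dist_nonneg (x := v) (y := w))
    have h3 : ((1 / 2 : NNReal) : ℝ) = 1 / 2 := by norm_num
    rw [h3]
    linarith
  set v := hS.fixedPoint with hv
  refine ⟨fun t => e t • v t, hcont v, fun t => ?_⟩
  have h1 : v t = (e t)⁻¹ • (x + ∫ s in τ..t, f s (e s • v s)) := by
    conv_lhs => rw [hv, ← hS.fixedPoint_isFixedPt.eq]
    rfl
  calc e t • v t = e t • ((e t)⁻¹ • (x + ∫ s in τ..t, f s (e s • v s))) := by rw [← h1]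
    _ = _ := smul_inv_smul₀ (he0 t).ne' _

/-! ### Lebesgue measurability in time and joint measurability of Carathéodory maps. -/

/-- The identity, from the line with the Lebesgue σ-algebra to the line with the Borel one. -/
def MeasureTheory.NullMeasurableSpace.toReal (t : NullMeasurableSpace ℝ volume) : ℝ := t

theorem MeasureTheory.NullMeasurableSpace.measurable_toReal :
    Measurable (NullMeasurableSpace.toReal) :=
  (measurable_id (α := ℝ)).nullMeasurable.measurable'

theorem MeasureTheory.NullMeasurableSpace.aemeasurable_of_measurable {F : Type*} [MeasurableSpace F]
    [MeasurableSpace.CountablyGenerated F] {g : ℝ → F}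
    (hg : Measurable (fun t : NullMeasurableSpace ℝ volume => g t)) : AEMeasurable g volume :=
  NullMeasurable.aemeasurable (fun _ hs => hg hs)

theorem AEMeasurable.measurable_nullMeasurableSpace {F : Type*} [MeasurableSpace F]
    {g : ℝ → F} (hg : AEMeasurable g volume) :
    Measurable (fun t : NullMeasurableSpace ℝ volume => g t) :=
  hg.nullMeasurable.measurable'

theorem measurable_indicator_of_measurable_domRestrict {F : Type*} [MeasurableSpace F] [Zero F]
    {u : ℝ → F} (hu : Measurable ((Ici (0 : ℝ)).domRestrict u)) :
    Measurable ((Ici (0 : ℝ)).indicator u) := by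
  refine measurable_of_restrict_of_restrict_compl (measurableSet_Ici (a := (0 : ℝ))) ?_ ?_
  · convert hu using 1
    ext t
    simp
  · convert measurable_const (a := (0 : F)) using 1
    ext t
    simp [indicator_of_notMem t.2]

theorem measurableSet_timeGraph_nullMeasurableSpace {V : Type*} [MeasurableSpace V]
    {U : ℝ → Set V} (hU : MeasurableSet (timeGraph U)) :
    MeasurableSet {p : NullMeasurableSpace ℝ volume × V | (p.1.toReal, p.2) ∈ timeGraph U} :=
  measurableSet_preimage ((NullMeasurableSpace.measurable_toReal.comp measurable_fst).prodMk
    measurable_snd) hU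

section Caratheodory

variable {S V F : Type*} [TopologicalSpace S] [TopologicalSpace V]
  [MeasurableSpace V] [TopologicalSpace F] [MeasurableSpace F] [Zero F] {U : ℝ → Set V}
  {a : ℝ → S → V → F}

/-- Membership in the graph does not involve the state, so the extension by zero stays continuous in
the state for every fixed (t, u), and separability of the state space gives joint measurability. -/
theorem IsCaratheodory.measurable_uncurry [MeasurableSpace S] [TopologicalSpace.MetrizableSpace S]
    [SecondCountableTopology S] [OpensMeasurableSpace S] [TopologicalSpace.PseudoMetrizableSpace F]
    [BorelSpace F] (ha : IsCaratheodory U a) :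
    Measurable (fun p : S × (NullMeasurableSpace ℝ volume × V) =>
      (timeGraph U).indicator (fun q : ℝ × V => a q.1 p.1 q.2) (p.2.1.toReal, p.2.2)) := by
  have hc : ∀ p : ℝ × V, Continuous fun y : S =>
      (timeGraph U).indicator (fun q : ℝ × V => a q.1 y q.2) p := by
    intro p
    by_cases hp : p ∈ timeGraph U
    · simp only [indicator_of_mem hp]
      refine continuousOn_univ.1 ((ha.continuous p.1 hp.1).comp (f := fun y : S => (y, p.2))
        (by fun_prop) fun y _ => ⟨mem_univ _, hp.2⟩)
    · simp only [indicator_of_notMem hp]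
      exact continuous_const
  exact measurable_uncurry_of_continuous_of_measurable
    (u := fun (y : S) (p : NullMeasurableSpace ℝ volume × V) =>
      (timeGraph U).indicator (fun q : ℝ × V => a q.1 y q.2) p) (fun p => hc p) ha.measurable_graph

theorem IsCaratheodory.continuousOn_control (ha : IsCaratheodory U a) {t : ℝ} (ht : 0 ≤ t) (x : S) :
    ContinuousOn (fun u => a t x u) (U t) :=
  (ha.continuous t ht).comp (f := fun u => (x, u)) (by fun_prop) fun _ hu => ⟨mem_univ _, hu⟩

end Caratheodory

/-! ### Relaxed controls as kernels and integrability of means. -/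

section Relaxed

variable {V : Type*} [NormedAddCommGroup V] [MeasurableSpace V] [BorelSpace V]

/-- A weakly measurable family of probability measures is a Markov kernel with respect to the
Lebesgue σ-algebra. -/
theorem exists_kernel_of_weakly_measurable {η : ℝ → ProbabilityMeasure V}
    (hη : ∀ φ : V →ᵇ ℝ,
      AEMeasurable (fun t => ∫ u, φ u ∂(η t : Measure V)) (volume.restrict (Ici 0))) :
    ∃ κ : ProbabilityTheory.Kernel (NullMeasurableSpace ℝ volume) V,
      ProbabilityTheory.IsMarkovKernel κ ∧ ∀ t : ℝ, 0 ≤ t → κ t = (η t : Measure V) := by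
  classical
  have hset : MeasurableSet {t : NullMeasurableSpace ℝ volume | 0 ≤ t.toReal} :=
    NullMeasurableSpace.measurable_toReal measurableSet_Ici
  -- Nothing is assumed about η at negative times; a fixed Dirac measure there keeps the family
  -- measurable and Markov.
  let m : NullMeasurableSpace ℝ volume → Measure V := fun t =>
    if 0 ≤ t.toReal then (η t.toReal : Measure V) else Measure.dirac 0
  have hprob : ∀ t, IsProbabilityMeasure (m t) := fun t => by
    by_cases ht : 0 ≤ t.toReal
    · simp only [m, if_pos ht]; infer_instance
    · simp only [m, if_neg ht]; infer_instance
  have hweak : ∀ φ : V →ᵇ ℝ, Measurable fun t => ∫ u, φ u ∂(m t) := by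
    intro φ
    have h1 : Measurable (fun t : NullMeasurableSpace ℝ volume =>
        (Ici (0 : ℝ)).indicator (fun t => ∫ u, φ u ∂(η t : Measure V)) t.toReal) :=
      AEMeasurable.measurable_nullMeasurableSpace
        ((aemeasurable_indicator_iff measurableSet_Ici).2 (hη φ))
    have h2 : (fun t => ∫ u, φ u ∂(m t)) = fun t : NullMeasurableSpace ℝ volume =>
        if 0 ≤ t.toReal then
          (Ici (0 : ℝ)).indicator (fun t => ∫ u, φ u ∂(η t : Measure V)) t.toReal else φ 0 := by
      funext t
      by_cases ht : 0 ≤ t.toReal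
      · simp only [m, if_pos ht]
        rw [indicator_of_mem (show t.toReal ∈ Ici (0 : ℝ) from ht)]
      · simp only [m, if_neg ht]
        exact integral_dirac' _ _ (φ.continuous.measurable.stronglyMeasurable)
    rw [h2]
    exact Measurable.ite hset h1 measurable_const
  -- Closed sets form a π-system generating the Borel sets, and the mass of a closed set is the
  -- limit of the integrals of its thickened indicators, which are bounded continuous test
  -- functions.
  have hm : Measurable m := by
    refine Measurable.measure_of_isPiSystem_of_isProbabilityMeasure
      (S := {s : Set V | IsClosed s}) ?_ isPiSystem_isClosed fun s hs => ?_
    · rw [BorelSpace.measurable_eq (α := V), borel_eq_generateFrom_isClosed]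
    · have hδ : ∀ n : ℕ, (0 : ℝ) < 1 / ((n : ℝ) + 1) := fun n => Nat.one_div_pos_of_nat
      have h1 : Measurable fun t => (m t).real s := by
        refine measurable_of_tendsto_metrizable (f := fun (n : ℕ) t =>
          ∫ u, ((thickenedIndicator (hδ n) s u : NNReal) : ℝ) ∂(m t)) (fun n => ?_) ?_
        · exact hweak (BoundedContinuousFunction.ofNormedAddCommGroup
            (fun u => ((thickenedIndicator (hδ n) s u : NNReal) : ℝ))
            (NNReal.continuous_coe.comp (thickenedIndicator (hδ n) s).continuous) 1 fun u => by
              rw [NNReal.norm_eq]; exact_mod_cast thickenedIndicator_le_one (hδ n) s u)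
        · rw [tendsto_pi_nhds]
          intro t
          exact tendsto_integral_thickenedIndicator_of_isClosed (m t) hs hδ
            tendsto_one_div_add_atTop_nhds_zero_nat
      simpa [measureReal_def] using h1.ennreal_ofReal
  refine ⟨⟨m, hm⟩, ⟨hprob⟩, fun t ht => ?_⟩
  change m t = _
  simp only [m]
  exact if_pos ht

theorem IsRelaxedControl.aemeasurable_setIntegral {U : ℝ → Set V}
    (hU : ∀ t, 0 ≤ t → MeasurableSet (U t)) {η : ℝ → ProbabilityMeasure V}
    (hη : IsRelaxedControl U η) {w : ℝ → V → ℝ}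
    (hw : Measurable (fun p : NullMeasurableSpace ℝ volume × V =>
      (timeGraph U).indicator (fun q : ℝ × V => w q.1 q.2) p)) :
    AEMeasurable (fun t => ∫ u in U t, w t u ∂(η t : Measure V)) (volume.restrict (Ici 0)) := by
  obtain ⟨κ, hκ, hκη⟩ := exists_kernel_of_weakly_measurable hη.1
  have h1 := (hw.stronglyMeasurable.integral_kernel_prod_right' (κ := κ)).measurable
  refine (NullMeasurableSpace.aemeasurable_of_measurable h1).restrict.congr ?_
  refine (ae_restrict_iff' measurableSet_Ici).2 (Filter.Eventually.of_forall fun t ht => ?_)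
  have ht : 0 ≤ t := ht
  simp only
  rw [hκη t ht, ← integral_indicator (hU t ht)]
  refine integral_congr_ae (Filter.Eventually.of_forall fun u => ?_)
  by_cases hu : u ∈ U t
  · have : (t, u) ∈ timeGraph U := ⟨ht, hu⟩
    simp only [indicator_of_mem hu]
    exact indicator_of_mem this _
  · have : (t, u) ∉ timeGraph U := fun h => hu h.2
    simp only [indicator_of_notMem hu]
    exact indicator_of_notMem this _

theorem MeasureTheory.LocallyIntegrableOn.intervalIntegrable_of_Ici {F : Type*}
    [NormedAddCommGroup F] {g : ℝ → F} (hg : LocallyIntegrableOn g (Ici 0) volume) {s t : ℝ}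
    (hs : 0 ≤ s) (ht : 0 ≤ t) : IntervalIntegrable g volume s t :=
  intervalIntegrable_iff.2 ((hg.integrableOn_compact_subset
    (fun _ hr => (le_min hs ht).trans hr.1) isCompact_uIcc).mono_set uIoc_subset_uIcc)

theorem MeasureTheory.LocallyIntegrableOn.locallyIntegrable_indicator {F : Type*}
    [NormedAddCommGroup F] {g : ℝ → F} (hg : LocallyIntegrableOn g (Ici 0) volume) :
    LocallyIntegrable ((Ici (0 : ℝ)).indicator g) volume := by
  rw [locallyIntegrable_iff]
  intro k hk
  rw [integrableOn_indicator_iff measurableSet_Ici]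
  exact hg.integrableOn_compact_subset inter_subset_left (hk.inter_left isClosed_Ici)

theorem IsRelaxedControl.intervalIntegrable_setIntegral {U : ℝ → Set V}
    (hU : ∀ t, 0 ≤ t → MeasurableSet (U t)) {η : ℝ → ProbabilityMeasure V}
    (hη : IsRelaxedControl U η) {w : ℝ → V → ℝ}
    (hw : IsCaratheodory U (fun t (_ : Unit) u => w t u))
    (hb : IsIntegrallyBounded U (fun t (_ : Unit) u => w t u)) {τ : ℝ} (hτ : 0 ≤ τ) :
    IntervalIntegrable (fun t => ∫ u in U t, w t u ∂(η t : Measure V)) volume 0 τ := by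
  obtain ⟨M, hM, hMb⟩ := hb (Icc 0 τ ×ˢ univ) (isCompact_Icc.prod isCompact_univ)
    (prod_mono Icc_subset_Ici_self le_rfl)
  refine (hM.2.intervalIntegrable_of_Ici le_rfl hτ).mono_fun' ?_ ?_
  · rw [uIoc_of_le hτ]
    exact ((hη.aemeasurable_setIntegral hU (hw.measurable_graph ())).mono_measure
      (Measure.restrict_mono (Ioc_subset_Icc_self.trans Icc_subset_Ici_self)
        le_rfl)).aestronglyMeasurable
  · rw [uIoc_of_le hτ]
    refine (ae_restrict_iff' measurableSet_Ioc).2 (Filter.Eventually.of_forall fun t ht => ?_)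
    have ht' : t ∈ Icc 0 τ := Ioc_subset_Icc_self ht
    have h1 := norm_setIntegral_le_of_norm_le_const (μ := (η t : Measure V)) (s := U t)
      (f := fun u => w t u) (C := M t) (measure_lt_top _ _)
      (fun u hu => hMb t () ⟨ht', mem_univ _⟩ u hu)
    refine h1.trans ?_
    have h2 : (η t : Measure V).real (U t) ≤ 1 := measureReal_le_one
    exact mul_le_of_le_one_right (hM.1 t ht'.1) h2

end Relaxed

theorem MeasureTheory.LocallyIntegrable.norm {F : Type*} [NormedAddCommGroup F] {g : ℝ → F}
    (hg : LocallyIntegrable g volume) : LocallyIntegrable (fun t => ‖g t‖) volume :=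
  fun t => let ⟨s, hs, hi⟩ := hg t; ⟨s, hs, hi.norm⟩

/-! ### Uniqueness of solutions. -/

section Solution

variable {E : Type*} [NormedAddCommGroup E] [NormedSpace ℝ E]

theorem IsSolution.sub_eq_integral {f : ℝ → E → E} {y : ℝ → E} (hy : IsSolution f y) {s t : ℝ}
    (hs : 0 ≤ s) (ht : 0 ≤ t) : y t - y s = ∫ r in s..t, f r (y r) := by
  rw [hy.2.2 t ht, hy.2.2 s hs, add_sub_add_left_eq_sub]
  exact intervalIntegral.integral_interval_sub_left (hy.2.1.intervalIntegrable_of_Ici le_rfl ht)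
    (hy.2.1.intervalIntegrable_of_Ici le_rfl hs)

theorem IsSolution.intervalIntegrable {f : ℝ → E → E} {y : ℝ → E} (hy : IsSolution f y) {s t : ℝ}
    (hs : 0 ≤ s) (ht : 0 ≤ t) : IntervalIntegrable (fun r => f r (y r)) volume s t :=
  hy.2.1.intervalIntegrable_of_Ici hs ht

theorem IsSolution.eqOn_of_lipschitz {f : ℝ → E → E} {L : ℝ → ℝ} (hL : LocallyIntegrable L volume)
    (hL0 : ∀ t, 0 ≤ L t) (hLip : ∀ t, 0 ≤ t → ∀ x x', ‖f t x - f t x'‖ ≤ L t * ‖x - x'‖)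
    {y z : ℝ → E} (hy : IsSolution f y) (hz : IsSolution f z) {τ : ℝ} (hτ : 0 ≤ τ)
    (h : y τ = z τ) : EqOn y z (Ici 0) := by
  intro t ht
  have ht : 0 ≤ t := ht
  have hsub : Icc 0 (max τ t) ⊆ Ici (0 : ℝ) := Icc_subset_Ici_self
  have h1 := le_zero_of_le_abs_integral_mul (a := 0) (b := max τ t) (τ := τ)
    (φ := fun s => ‖y s - z s‖)
    ⟨hτ, le_max_left _ _⟩ hL hL0 ((hy.1.mono hsub).sub (hz.1.mono hsub)).norm ?_
    (fun _ _ => norm_nonneg _) t ⟨ht, le_max_right _ _⟩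
  · exact sub_eq_zero.1 (norm_le_zero_iff.1 h1)
  · intro s hs
    have h2 : y s - z s = ∫ r in τ..s, (f r (y r) - f r (z r)) := by
      rw [intervalIntegral.integral_sub (hy.intervalIntegrable hτ hs.1)
        (hz.intervalIntegrable hτ hs.1), ← hy.sub_eq_integral hτ hs.1,
        ← hz.sub_eq_integral hτ hs.1, h]
      abel
    have hsub' : uIcc τ s ⊆ Ici (0 : ℝ) := fun r hr => (le_min hτ hs.1).trans hr.1
    rw [h2]
    refine intervalIntegral.norm_integral_le_abs_of_norm_le ?_ ?_
    · refine (ae_restrict_iff' measurableSet_uIoc).2 (Filter.Eventually.of_forall fun r hr => ?_)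
      exact hLip r (hsub' (uIoc_subset_uIcc hr)) _ _
    · exact hL.intervalIntegrable.mul_continuousOn ((hy.1.mono hsub').sub (hz.1.mono hsub')).norm

end Solution

/-! ### Solutions for the admissible control. -/

section System

variable {V : Type*} [NormedAddCommGroup V] [MeasurableSpace V]
  {E : Type*} [NormedAddCommGroup E] [MeasurableSpace E] [BorelSpace E]
  {U : ℝ → Set V} {a : ℝ → E → V → E} {u₀ : ℝ → V}

/-- Measurability of the right-hand side along a measurable curve and an admissible control. -/
theorem IsCaratheodory.measurable_indicator_comp [SecondCountableTopology E]
    (ha : IsCaratheodory U a) (hu₀ : IsAdmissibleControl U u₀) {ξ : ℝ → E} (hξ : Measurable ξ) :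
    Measurable (fun t : NullMeasurableSpace ℝ volume =>
      (Ici (0 : ℝ)).indicator (fun t => a t (ξ t) (u₀ t)) t.toReal) := by
  have h1 : Measurable (fun t : NullMeasurableSpace ℝ volume =>
      (ξ t.toReal, (t, (Ici (0 : ℝ)).indicator u₀ t.toReal))) :=
    (hξ.comp NullMeasurableSpace.measurable_toReal).prodMk (measurable_id.prodMk
      ((measurable_indicator_of_measurable_domRestrict hu₀.1).comp
        NullMeasurableSpace.measurable_toReal))
  convert ha.measurable_uncurry.comp h1 using 1
  funext t
  simp only [Function.comp]
  by_cases ht : t.toReal ∈ Ici (0 : ℝ)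
  · have hg : (t.toReal, u₀ t.toReal) ∈ timeGraph U := ⟨ht, hu₀.2 _ ht⟩
    simp only [indicator_of_mem ht]
    exact (indicator_of_mem hg (fun q : ℝ × V => a q.1 (ξ t.toReal) q.2)).symm
  · rw [indicator_of_notMem ht]
    exact (indicator_of_notMem (fun h => ht h.1) _).symm

theorem ConditionA.locallyIntegrable_zero [NormedSpace ℝ E] [SecondCountableTopology E]
    (ha : ConditionA U a) (hu₀ : IsAdmissibleControl U u₀) :
    LocallyIntegrable ((Ici (0 : ℝ)).indicator (fun t => a t 0 (u₀ t))) volume := by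
  have hm : AEStronglyMeasurable ((Ici (0 : ℝ)).indicator (fun t => a t 0 (u₀ t))) volume :=
    (NullMeasurableSpace.aemeasurable_of_measurable (ha.caratheodory.measurable_indicator_comp hu₀
      measurable_const)).aestronglyMeasurable
  rw [locallyIntegrable_iff]
  intro k hk
  have hk' : IsCompact (k ∩ Ici 0) := hk.inter_right isClosed_Ici
  obtain ⟨M, hM, hMb⟩ := ha.bounded ((k ∩ Ici 0) ×ˢ {0}) (hk'.prod isCompact_singleton)
    (prod_mono inter_subset_right (subset_univ _))
  rw [integrableOn_indicator_iff measurableSet_Ici, inter_comm]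
  refine (hM.2.integrableOn_compact_subset inter_subset_right hk').mono'
    ((aestronglyMeasurable_indicator_iff measurableSet_Ici).1 hm |>.mono_measure
      (Measure.restrict_mono inter_subset_right le_rfl)) ?_
  refine ae_restrict_of_forall_mem (hk'.measurableSet) fun t ht => ?_
  exact hMb t 0 ⟨ht, rfl⟩ _ (hu₀.2 t ht.2)

theorem ConditionA.exists_unique_solutionThrough [NormedSpace ℝ E] [CompleteSpace E]
    [SecondCountableTopology E] (ha : ConditionA U a) (hu₀ : IsAdmissibleControl U u₀) {τ : ℝ}
    (hτ : 0 ≤ τ) (x : E) :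
    ∃ y, IsSolutionThrough a u₀ τ x y ∧
      ∀ z, IsSolutionThrough a u₀ τ x z → EqOn z y (Ici 0) := by
  obtain ⟨L, hL, hLip⟩ := ha.continuable.2
  set L' : ℝ → ℝ := (Ici (0 : ℝ)).indicator L with hL'
  have hL'i : LocallyIntegrable L' volume := hL.2.locallyIntegrable_indicator
  have hL'0 : ∀ t, 0 ≤ L' t := indicator_nonneg fun t ht => hL.1 t ht
  have hLip0 : ∀ t, 0 ≤ t → ∀ x x', ‖a t x (u₀ t) - a t x' (u₀ t)‖ ≤ L' t * ‖x - x'‖ := by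
    intro t ht x x'
    rw [hL', indicator_of_mem (show t ∈ Ici (0 : ℝ) from ht)]
    exact hLip t ht x x' _ (hu₀.2 t ht)
  -- Extension by zero to negative times makes the existence theorem on the whole line applicable.
  set f : ℝ → E → E := fun t x => (Ici (0 : ℝ)).indicator (fun t => a t x (u₀ t)) t with hf
  have hf_eq : ∀ t, 0 ≤ t → ∀ x, f t x = a t x (u₀ t) := fun t ht x =>
    indicator_of_mem (show t ∈ Ici (0 : ℝ) from ht) _
  have hf_neg : ∀ t, ¬ 0 ≤ t → ∀ x, f t x = 0 := fun t ht x =>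
    indicator_of_notMem (show t ∉ Ici (0 : ℝ) from ht) _
  -- The enlarged coefficient dominates both the Lipschitz constant and the value at the zero state,
  -- as the existence theorem requires of a single function.
  have hfLip : ∀ t x x', ‖f t x - f t x'‖ ≤ (L' t + ‖f t 0‖) * ‖x - x'‖ := by
    intro t x x'
    by_cases ht : 0 ≤ t
    · rw [hf_eq t ht x, hf_eq t ht x']
      refine (hLip0 t ht x x').trans (mul_le_mul_of_nonneg_right ?_ (norm_nonneg _))
      exact le_add_of_nonneg_right (norm_nonneg _)
    · rw [hf_neg t ht, hf_neg t ht, sub_self, norm_zero]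
      exact mul_nonneg (add_nonneg (hL'0 t) (norm_nonneg _)) (norm_nonneg _)
  have hf0i : LocallyIntegrable (fun t => L' t + ‖f t 0‖) volume :=
    hL'i.add (ha.locallyIntegrable_zero hu₀).norm
  have hf0 : ∀ t, ‖f t 0‖ ≤ L' t + ‖f t 0‖ := fun t => le_add_of_nonneg_left (hL'0 t)
  have hfm : ∀ y : ℝ → E, Continuous y → AEStronglyMeasurable (fun s => f s (y s)) volume :=
    fun y hy => (NullMeasurableSpace.aemeasurable_of_measurable
      (ha.caratheodory.measurable_indicator_comp hu₀ hy.measurable)).aestronglyMeasurable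
  obtain ⟨y, hyc, hy⟩ := exists_global_solution_of_lipschitz hf0i hfLip hf0 hfm τ x
  have hyi := locallyIntegrable_comp_of_lipschitz hf0i hfLip hf0 hyc (hfm y hyc)
  have hsol : IsSolutionThrough a u₀ τ x y := by
    refine ⟨⟨hyc.continuousOn, ?_, fun t ht => ?_⟩, by rw [hy τ]; simp⟩
    · refine (locallyIntegrableOn_congr (f := fun s => f s (y s)) ?_).1 (hyi.locallyIntegrableOn _)
      exact ae_restrict_of_forall_mem measurableSet_Ici fun s hs => hf_eq s hs _
    · have h1 : ∫ s in (0 : ℝ)..t, a s (y s) (u₀ s) = ∫ s in (0 : ℝ)..t, f s (y s) := by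
        refine intervalIntegral.integral_congr fun s hs => ?_
        rw [uIcc_of_le ht] at hs
        exact (hf_eq s hs.1 _).symm
      have h2 : y t - y 0 = ∫ s in (0 : ℝ)..t, f s (y s) := by
        rw [hy t, hy 0, add_sub_add_left_eq_sub]
        exact intervalIntegral.integral_interval_sub_left hyi.intervalIntegrable
          hyi.intervalIntegrable
      rw [h1, ← h2]
      abel
  exact ⟨y, hsol, fun z hz => hz.1.eqOn_of_lipschitz hL'i hL'0 hLip0 hsol.1 hτ
    (hz.2.trans hsol.2.symm)⟩

end System

/-! ### The weight: bounds, continuity, measurability. -/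

/-- The largest deviation of `a t x u` from `a t x (u₀ t)` over the ball `‖x‖ ≤ ρ t`. -/
noncomputable def deviation {E V : Type*} [NormedAddCommGroup E] [NormedSpace ℝ E]
    (a : ℝ → E → V → E) (u₀ : ℝ → V) (ρ : ℝ → ℝ) (t : ℝ) (u : V) : ℝ :=
  sSup ((fun e => ‖a t (ρ t • e) u - a t (ρ t • e) (u₀ t)‖) '' Metric.closedBall (0 : E) 1)

/-- The weight that dominates the displacement of the initial value. -/
noncomputable def deviationWeight {E V : Type*} [NormedAddCommGroup E] [NormedSpace ℝ E]
    [NormedAddCommGroup V] (U : ℝ → Set V) (a : ℝ → E → V → E) (u₀ : ℝ → V) (ρ L : ℝ → ℝ)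
    (t : ℝ) : V → ℝ :=
  (U t).indicator fun u =>
    Real.exp (∫ s in (0 : ℝ)..t, L s) * deviation a u₀ ρ t u + ‖u - u₀ t‖

section Weight

variable {E V : Type*} [NormedAddCommGroup E] [NormedSpace ℝ E] {U : ℝ → Set V}
  {a : ℝ → E → V → E} {u₀ : ℝ → V} {ρ L : ℝ → ℝ}

theorem deviation_nonneg (t : ℝ) (u : V) : 0 ≤ deviation a u₀ ρ t u :=
  Real.sSup_nonneg (by rintro _ ⟨e, _, rfl⟩; exact norm_nonneg _)

theorem deviation_le {t M : ℝ} {u : V} (hM : ∀ x : E, ‖x‖ ≤ |ρ t| → ‖a t x u‖ ≤ M)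
    (hM₀ : ∀ x : E, ‖x‖ ≤ |ρ t| → ‖a t x (u₀ t)‖ ≤ M) : deviation a u₀ ρ t u ≤ M + M := by
  refine csSup_le ⟨_, 0, by simp, rfl⟩ ?_
  rintro _ ⟨e, he, rfl⟩
  have hx : ‖ρ t • e‖ ≤ |ρ t| := by
    rw [norm_smul, Real.norm_eq_abs]
    exact mul_le_of_le_one_right (abs_nonneg _) (mem_closedBall_zero_iff.1 he)
  exact (norm_sub_le _ _).trans (add_le_add (hM _ hx) (hM₀ _ hx))

variable [NormedAddCommGroup V]

theorem deviationWeight_nonneg (t : ℝ) (u : V) : 0 ≤ deviationWeight U a u₀ ρ L t u :=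
  indicator_nonneg (fun u _ => add_nonneg (mul_nonneg (Real.exp_pos _).le (deviation_nonneg t u))
    (norm_nonneg _)) u

theorem norm_sub_le_deviationWeight {t : ℝ} {u : V} (hu : u ∈ U t) :
    ‖u - u₀ t‖ ≤ deviationWeight U a u₀ ρ L t u := by
  rw [deviationWeight, indicator_of_mem hu]
  exact le_add_of_nonneg_left (mul_nonneg (Real.exp_pos _).le (deviation_nonneg t u))

theorem exp_mul_deviation_le_deviationWeight {t : ℝ} {u : V} (hu : u ∈ U t) :
    Real.exp (∫ s in (0 : ℝ)..t, L s) * deviation a u₀ ρ t u ≤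
      deviationWeight U a u₀ ρ L t u := by
  rw [deviationWeight, indicator_of_mem hu]
  exact le_add_of_nonneg_right (norm_nonneg _)

theorem deviationWeight_self (t : ℝ) : deviationWeight U a u₀ ρ L t (u₀ t) = 0 := by
  have : deviation a u₀ ρ t (u₀ t) = 0 := by
    simp [deviation, (Metric.nonempty_closedBall (x := (0 : E)) (ε := 1)).2 zero_le_one]
  by_cases h : u₀ t ∈ U t
  · rw [deviationWeight, indicator_of_mem h, this]
    simp
  · exact indicator_of_notMem h _

end Weight

section Deviation

variable {V : Type*} [NormedAddCommGroup V] [MeasurableSpace V]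
  {E : Type*} [NormedAddCommGroup E] [NormedSpace ℝ E] [MeasurableSpace E]
  {U : ℝ → Set V} {a : ℝ → E → V → E} {u₀ : ℝ → V} {ρ L : ℝ → ℝ}

theorem IsCaratheodory.continuousOn_state_control (ha : IsCaratheodory U a)
    (hu₀ : IsAdmissibleControl U u₀) {t : ℝ} (ht : 0 ≤ t) :
    ContinuousOn (fun p : V × E => ‖a t (ρ t • p.2) p.1 - a t (ρ t • p.2) (u₀ t)‖)
      (U t ×ˢ univ) := by
  refine ((ha.continuous t ht).comp (f := fun p : V × E => (ρ t • p.2, p.1)) (by fun_prop)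
    fun p hp => ⟨mem_univ _, hp.1⟩).sub
    ((ha.continuous t ht).comp (f := fun p : V × E => (ρ t • p.2, u₀ t)) (by fun_prop)
    fun p hp => ⟨mem_univ _, hu₀.2 t ht⟩) |>.norm

theorem IsCaratheodory.continuous_deviation_state (ha : IsCaratheodory U a)
    (hu₀ : IsAdmissibleControl U u₀) {t : ℝ} (ht : 0 ≤ t) {u : V} (hu : u ∈ U t) :
    Continuous fun e : E => ‖a t (ρ t • e) u - a t (ρ t • e) (u₀ t)‖ :=
  continuousOn_univ.1 ((ha.continuousOn_state_control hu₀ ht).comp (f := fun e : E => (u, e))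
    (by fun_prop) fun _ _ => ⟨hu, mem_univ _⟩)

theorem norm_sub_le_deviation [ProperSpace E] (ha : IsCaratheodory U a)
    (hu₀ : IsAdmissibleControl U u₀) {t : ℝ} (ht : 0 ≤ t) {u : V} (hu : u ∈ U t) {x : E}
    (hx : ‖x‖ ≤ ρ t) : ‖a t x u - a t x (u₀ t)‖ ≤ deviation a u₀ ρ t u := by
  obtain ⟨e, he, rfl⟩ : ∃ e ∈ Metric.closedBall (0 : E) 1, ρ t • e = x := by
    rcases eq_or_ne (ρ t) 0 with h0 | h0
    · refine ⟨0, by simp, ?_⟩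
      rw [h0, norm_le_zero_iff] at hx
      simp [hx]
    · have hpos : 0 < ρ t := lt_of_le_of_ne ((norm_nonneg x).trans hx) h0.symm
      refine ⟨(ρ t)⁻¹ • x, ?_, smul_inv_smul₀ h0 x⟩
      rw [mem_closedBall_zero_iff, norm_smul, norm_inv, Real.norm_eq_abs, abs_of_pos hpos,
        inv_mul_le_iff₀ hpos, mul_one]
      exact hx
  exact le_csSup ((isCompact_closedBall (0 : E) 1).image
    (ha.continuous_deviation_state hu₀ ht hu)).bddAbove ⟨e, he, rfl⟩

/-- Parametrising the ball of radius `ρ t` by `ρ t • e` lets the supremum run over the fixed compact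
unit ball, where a supremum of a jointly continuous function is continuous in the parameter. -/
theorem continuousOn_deviation [ProperSpace E] (ha : IsCaratheodory U a)
    (hu₀ : IsAdmissibleControl U u₀) {t : ℝ} (ht : 0 ≤ t) :
    ContinuousOn (deviation a u₀ ρ t) (U t) := by
  rw [continuousOn_iff_continuous_domRestrict]
  refine IsCompact.continuous_sSup (f := fun (u : U t) (e : E) =>
    ‖a t (ρ t • e) u - a t (ρ t • e) (u₀ t)‖) (isCompact_closedBall (0 : E) 1) ?_
  exact continuousOn_univ.1 ((ha.continuousOn_state_control hu₀ ht).comp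
    (f := fun p : U t × E => ((p.1 : V), p.2)) (by fun_prop) fun p _ => ⟨p.1.2, mem_univ _⟩)

theorem continuousOn_deviationWeight [ProperSpace E] (ha : IsCaratheodory U a)
    (hu₀ : IsAdmissibleControl U u₀) {t : ℝ} (ht : 0 ≤ t) :
    ContinuousOn (deviationWeight U a u₀ ρ L t) (U t) := by
  refine ((continuousOn_const.mul (continuousOn_deviation ha hu₀ ht)).add
    (f := fun u => Real.exp (∫ s in (0 : ℝ)..t, L s) * deviation a u₀ ρ t u)
    (g := fun u => ‖u - u₀ t‖) (by fun_prop)).congr fun u hu => ?_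
  exact indicator_of_mem hu _

/-- By continuity in e, the supremum over the unit ball equals the one over a countable dense subset
independent of time and control. -/
theorem measurable_deviationWeight [BorelSpace E] [BorelSpace V] [SecondCountableTopology E]
    [SecondCountableTopology V] (hU : MeasurableSet (timeGraph U))
    (ha : IsCaratheodory U a) (hu₀ : IsAdmissibleControl U u₀)
    (hL : LocallyIntegrable L volume) (hρ : Measurable ρ) :
    Measurable (fun p : NullMeasurableSpace ℝ volume × V =>
      (timeGraph U).indicator (fun q : ℝ × V => deviationWeight U a u₀ ρ L q.1 q.2)
        (p.1.toReal, p.2)) := by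
  obtain ⟨D, hDc, hDd⟩ := TopologicalSpace.exists_countable_dense (Metric.closedBall (0 : E) 1)
  have : Countable D := hDc.to_subtype
  have htime : Measurable fun p : NullMeasurableSpace ℝ volume × V => p.1.toReal :=
    NullMeasurableSpace.measurable_toReal.comp measurable_fst
  have hu₁ : Measurable fun p : NullMeasurableSpace ℝ volume × V =>
      (Ici (0 : ℝ)).indicator u₀ p.1.toReal :=
    (measurable_indicator_of_measurable_domRestrict hu₀.1).comp htime
  have hx : ∀ e : E, Measurable fun p : NullMeasurableSpace ℝ volume × V => ρ p.1.toReal • e :=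
    fun e => (hρ.comp htime).smul_const e
  have hA : ∀ e : E, Measurable fun p : NullMeasurableSpace ℝ volume × V =>
      (timeGraph U).indicator (fun q : ℝ × V => a q.1 (ρ p.1.toReal • e) q.2)
        (p.1.toReal, p.2) := fun e =>
    ha.measurable_uncurry.comp ((hx e).prodMk (measurable_fst.prodMk measurable_snd))
  have hA₀ : ∀ e : E, Measurable fun p : NullMeasurableSpace ℝ volume × V =>
      (timeGraph U).indicator (fun q : ℝ × V => a q.1 (ρ p.1.toReal • e) q.2)
        (p.1.toReal, (Ici (0 : ℝ)).indicator u₀ p.1.toReal) := fun e =>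
    ha.measurable_uncurry.comp ((hx e).prodMk (measurable_fst.prodMk hu₁))
  have hsup : Measurable fun p : NullMeasurableSpace ℝ volume × V => ⨆ e : D,
      ‖(timeGraph U).indicator (fun q : ℝ × V => a q.1 (ρ p.1.toReal • (e : E)) q.2)
        (p.1.toReal, p.2) -
      (timeGraph U).indicator (fun q : ℝ × V => a q.1 (ρ p.1.toReal • (e : E)) q.2)
        (p.1.toReal, (Ici (0 : ℝ)).indicator u₀ p.1.toReal)‖ :=
    Measurable.iSup fun e => ((hA _).sub (hA₀ _)).norm
  have hexp : Measurable fun p : NullMeasurableSpace ℝ volume × V =>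
      Real.exp (∫ s in (0 : ℝ)..p.1.toReal, L s) :=
    (Real.continuous_exp.comp (hL.continuous_integral 0)).measurable.comp htime
  have htot := ((hexp.mul hsup).add (measurable_snd.sub hu₁).norm).indicator
    (measurableSet_timeGraph_nullMeasurableSpace hU)
  convert htot using 1
  funext p
  by_cases hp : (p.1.toReal, p.2) ∈ timeGraph U
  · have hp₀ : (p.1.toReal, u₀ p.1.toReal) ∈ timeGraph U := ⟨hp.1, hu₀.2 _ hp.1⟩
    have hdev : deviation a u₀ ρ p.1.toReal p.2 = ⨆ e : D,
        ‖a p.1.toReal (ρ p.1.toReal • (e : E)) p.2 -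
          a p.1.toReal (ρ p.1.toReal • (e : E)) (u₀ p.1.toReal)‖ := by
      rw [deviation, sSup_image']
      exact (hDd.ciSup' ((ha.continuous_deviation_state hu₀ hp.1 hp.2).comp
        continuous_subtype_val)).symm
    have hp' : p ∈ {p : NullMeasurableSpace ℝ volume × V | (p.1.toReal, p.2) ∈ timeGraph U} := hp
    rw [indicator_of_mem hp, indicator_of_mem hp']
    simp only [indicator_of_mem hp, Pi.add_apply, Pi.mul_apply, Pi.sub_apply,
      indicator_of_mem (show p.1.toReal ∈ Ici (0 : ℝ) from hp.1), indicator_of_mem hp₀]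
    rw [deviationWeight, indicator_of_mem hp.2, hdev]
  · rw [indicator_of_notMem hp]
    exact (indicator_of_notMem (s := {p | _}) hp _).symm

end Deviation

/-- Local boundedness of `ρ` puts all balls for t in [0, N] into one compact ball, where a single
integrable bound for `a` applies; the exponential is largest at N because `L` is nonnegative. -/
theorem isIntegrallyBounded_deviationWeight {V : Type*} [NormedAddCommGroup V]
    [MeasurableSpace V] {E : Type*} [NormedAddCommGroup E] [NormedSpace ℝ E] [MeasurableSpace E]
    [ProperSpace E] {U : ℝ → Set V} {a : ℝ → E → V → E} {u₀ : ℝ → V} {ρ L : ℝ → ℝ} (hU : ConditionU U) (ha : ConditionA U a)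
    (hu₀ : IsAdmissibleControl U u₀) (hL : LocallyIntegrable L volume) (hL0 : ∀ t, 0 ≤ L t)
    (hρ : ∀ N : ℝ, ∃ R, ∀ t ∈ Icc 0 N, |ρ t| ≤ R) :
    IsIntegrallyBounded U (fun t (_ : Unit) u => deviationWeight U a u₀ ρ L t u) := by
  intro K hK hK0
  obtain ⟨N, hN⟩ := (hK.image continuous_fst).bddAbove
  have hKN : ∀ t x, (t, x) ∈ K → t ∈ Icc 0 N := fun t x h =>
    ⟨(hK0 h).1, hN ⟨(t, x), h, rfl⟩⟩
  obtain ⟨R, hR⟩ := hρ N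
  obtain ⟨M₁, hM₁, hb₁⟩ := ha.bounded (Icc 0 N ×ˢ Metric.closedBall 0 R)
    (isCompact_Icc.prod (isCompact_closedBall _ _)) (prod_mono Icc_subset_Ici_self (subset_univ _))
  obtain ⟨M₂, hM₂, hb₂⟩ := hU.bounded (Icc 0 N) isCompact_Icc Icc_subset_Ici_self
  set C := Real.exp (∫ s in (0 : ℝ)..N, L s) with hC
  have hC0 : 0 ≤ C := (Real.exp_pos _).le
  refine ⟨fun t => C * (M₁ t + M₁ t) + (M₂ t + M₂ t), ⟨fun t ht => ?_, ?_⟩, ?_⟩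
  · exact add_nonneg (mul_nonneg hC0 (add_nonneg (hM₁.1 t ht) (hM₁.1 t ht)))
      (add_nonneg (hM₂.1 t ht) (hM₂.1 t ht))
  · exact ((hM₁.2.add hM₁.2).smul C).add (hM₂.2.add hM₂.2)
  · intro t x htx u hu
    have ht := hKN t x htx
    have hu' := hu₀.2 t ht.1
    rw [Real.norm_eq_abs, abs_of_nonneg (deviationWeight_nonneg t u), deviationWeight,
      indicator_of_mem hu]
    have h1 : deviation a u₀ ρ t u ≤ M₁ t + M₁ t := deviation_le
      (fun x hx => hb₁ t x ⟨ht, mem_closedBall_zero_iff.2 (hx.trans (hR t ht))⟩ u hu)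
      (fun x hx => hb₁ t x ⟨ht, mem_closedBall_zero_iff.2 (hx.trans (hR t ht))⟩ _ hu')
    have h2 : Real.exp (∫ s in (0 : ℝ)..t, L s) ≤ C := by
      refine Real.exp_le_exp.2 (intervalIntegral.integral_mono_interval le_rfl ht.1 ht.2
        (Filter.Eventually.of_forall hL0) hL.intervalIntegrable)
    exact add_le_add (mul_le_mul h2 h1 (deviation_nonneg t u) hC0)
      ((norm_sub_le _ _).trans (add_le_add (hb₂ t ht u hu) (hb₂ t ht _ hu')))

/-- A nonnegative function with zero integral vanishes almost everywhere, so the identity map is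
ν-a.e. equal to `v`, and pushing ν forward along both maps identifies it with the Dirac measure. -/
theorem eq_diracProba_of_setIntegral_eq_zero {V : Type*} [NormedAddCommGroup V]
    [MeasurableSpace V] {A : Set V} (hA : MeasurableSet A)
    {ν : ProbabilityMeasure V} (hν : (ν : Measure V) A = 1) {v : V} {g : V → ℝ}
    (hg : ∀ u ∈ A, ‖u - v‖ ≤ g u) (hi : IntegrableOn g A (ν : Measure V))
    (h : ∫ u in A, g u ∂(ν : Measure V) = 0) : ν = diracProba v := by
  have h0 : 0 ≤ᵐ[(ν : Measure V).restrict A] g :=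
    ae_restrict_of_forall_mem hA fun u hu => (norm_nonneg _).trans (hg u hu)
  have h1 := (setIntegral_eq_zero_iff_of_nonneg_ae h0 hi).1 h
  have h2 : ∀ᵐ u ∂(ν : Measure V), u ∈ A := by
    rw [← prob_compl_eq_zero_iff hA] at hν
    exact hν
  have h3 : (id : V → V) =ᵐ[(ν : Measure V)] fun _ => v := by
    filter_upwards [(ae_restrict_iff' hA).1 h1, h2] with u hu huA
    have h4 := hg u huA
    rw [hu huA] at h4
    exact sub_eq_zero.1 (norm_le_zero_iff.1 h4)
  have h4 := Measure.map_congr (mβ := inferInstance) h3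
  rw [Measure.map_id, Measure.map_const, measure_univ, one_smul] at h4
  exact Subtype.ext h4

/-! ### The weight is a null weight and dominates the displacement. -/

section NullWeight

variable {V : Type*} [NormedAddCommGroup V] [MeasurableSpace V] [BorelSpace V]
  [SecondCountableTopology V]
  {E : Type*} [NormedAddCommGroup E] [NormedSpace ℝ E] [MeasurableSpace E] [BorelSpace E]
  [ProperSpace E]
  {U : ℝ → Set V} {a : ℝ → E → V → E} {u₀ : ℝ → V} {ρ L : ℝ → ℝ}

theorem isCaratheodory_deviationWeight (hU : MeasurableSet (timeGraph U))
    (ha : IsCaratheodory U a) (hu₀ : IsAdmissibleControl U u₀)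
    (hL : LocallyIntegrable L volume) (hρ : Measurable ρ) :
    IsCaratheodory U (fun t (_ : Unit) u => deviationWeight U a u₀ ρ L t u) := by
  have hm := measurable_deviationWeight hU ha hu₀ hL hρ
  refine ⟨fun _ u _ => ?_, fun _ => hm, fun t ht => ?_⟩
  -- A fixed u may leave U(t) as t varies, and `a` is not controlled there; the weight is cut off to
  -- zero outside U(t), so it agrees with its extension from the graph.
  · have h1 : Measurable fun t : NullMeasurableSpace ℝ volume =>
        (timeGraph U).indicator (fun q : ℝ × V => deviationWeight U a u₀ ρ L q.1 q.2)
          (t.toReal, u) := hm.comp (measurable_id.prodMk measurable_const)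
    refine (NullMeasurableSpace.aemeasurable_of_measurable
      (g := fun t => (timeGraph U).indicator
        (fun q : ℝ × V => deviationWeight U a u₀ ρ L q.1 q.2) (t, u)) h1).restrict.congr ?_
    refine ae_restrict_of_forall_mem measurableSet_Ici fun t ht => ?_
    by_cases hu : u ∈ U t
    · exact indicator_of_mem (show (t, u) ∈ timeGraph U from ⟨ht, hu⟩) _
    · exact (indicator_of_notMem (show (t, u) ∉ timeGraph U from fun h => hu h.2) _).trans
        (indicator_of_notMem hu _).symm
  · exact (continuousOn_deviationWeight ha hu₀ ht).comp continuousOn_snd fun p hp => hp.2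

theorem isNullWeight_deviationWeight (hU : ConditionU U) (ha : ConditionA U a)
    (hu₀ : IsAdmissibleControl U u₀) (hL : LocallyIntegrable L volume) (hL0 : ∀ t, 0 ≤ L t)
    (hρm : Measurable ρ) (hρ : ∀ N : ℝ, ∃ R, ∀ t ∈ Icc 0 N, |ρ t| ≤ R) :
    IsNullWeight U u₀ (deviationWeight U a u₀ ρ L) := by
  classical
  have hUm : ∀ t, 0 ≤ t → MeasurableSet (U t) := fun t ht => (hU.isCompact t ht).measurableSet
  have hcar := isCaratheodory_deviationWeight hU.measurableSet_graph ha.caratheodory hu₀ hL hρm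
  have hbdd := isIntegrallyBounded_deviationWeight hU ha hu₀ hL hL0 hρ
  refine ⟨fun t _ u => deviationWeight_nonneg t u, hcar, hbdd, fun τ _ => ?_, ?_⟩
  · have h1 : ∀ t, ∫ u in U t, deviationWeight U a u₀ ρ L t u
        ∂((diracProba (u₀ t) : ProbabilityMeasure V) : Measure V) = 0 := by
      intro t
      change ∫ u in U t, deviationWeight U a u₀ ρ L t u ∂(Measure.dirac (u₀ t)) = 0
      rw [setIntegral_dirac, deviationWeight_self, ite_self]
    simp only [weightIntegral, h1, intervalIntegral.integral_zero]
  · intro η hη τ hτ h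
    have hi := hη.1.intervalIntegrable_setIntegral hUm hcar hbdd hτ
    rw [weightIntegral, intervalIntegral.integral_of_le hτ,
      setIntegral_eq_zero_iff_of_nonneg_ae (Filter.Eventually.of_forall fun t =>
        integral_nonneg fun u => deviationWeight_nonneg t u) hi.1] at h
    rw [restrict_Ioc_eq_restrict_Icc] at h
    have hη1 : ∀ᵐ t ∂(volume.restrict (Icc 0 τ)), (η t : Measure V) (U t) = 1 :=
      ae_restrict_of_ae_restrict_of_subset Icc_subset_Ici_self hη.1.2
    filter_upwards [h, hη1, ae_restrict_mem measurableSet_Icc] with t ht ht1 htm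
    exact eq_diracProba_of_setIntegral_eq_zero (hUm t htm.1) ht1
      (fun u hu => norm_sub_le_deviationWeight hu)
      ((continuousOn_deviationWeight ha.caratheodory hu₀ htm.1).integrableOn_compact
        (hU.isCompact t htm.1)) ht

/-- The displacement of the initial value is dominated by the weight. -/
theorem norm_sub_le_weightIntegral (hU : ConditionU U) (ha : ConditionA U a)
    (hu₀ : IsAdmissibleControl U u₀) (hL : LocallyIntegrable L volume) (hL0 : ∀ t, 0 ≤ L t)
    (hLip : ∀ t, 0 ≤ t → ∀ x x', ‖a t x (u₀ t) - a t x' (u₀ t)‖ ≤ L t * ‖x - x'‖)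
    (hρm : Measurable ρ) (hρ : ∀ N : ℝ, ∃ R, ∀ t ∈ Icc 0 N, |ρ t| ≤ R)
    {η : ℝ → ProbabilityMeasure V} (hη : IsRelaxedControl U η) {y z : ℝ → E}
    (hy : IsTrajectory U a η y) (hz : IsSolution (fun t x => a t x (u₀ t)) z) {τ : ℝ}
    (hτ : 0 ≤ τ) (hzy : z τ = y τ) (hyρ : ∀ t ∈ Icc 0 τ, ‖y t‖ ≤ ρ t) :
    ‖z 0 - y 0‖ ≤ weightIntegral U (deviationWeight U a u₀ ρ L) η τ := by
  have hUm : ∀ t, 0 ≤ t → MeasurableSet (U t) := fun t ht => (hU.isCompact t ht).measurableSet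
  have hcar := isCaratheodory_deviationWeight hU.measurableSet_graph ha.caratheodory hu₀ hL hρm
  have hbdd := isIntegrallyBounded_deviationWeight hU ha hu₀ hL hL0 hρ
  set W : ℝ → ℝ := fun t => ∫ u in U t, deviationWeight U a u₀ ρ L t u ∂(η t : Measure V) with hW
  have hWi : IntervalIntegrable W volume 0 τ :=
    hη.intervalIntegrable_setIntegral hUm hcar hbdd hτ
  set Λ : ℝ → ℝ := fun t => ∫ s in (0 : ℝ)..t, L s with hΛ
  have hΛc : Continuous Λ := hL.continuous_integral 0
  -- The weight already carries the factor exp(Λ), so the inhomogeneity is exp(−Λ) W and the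
  -- Grönwall factor cancels exactly.
  have hhi : IntervalIntegrable (fun t => Real.exp (-Λ t) * W t) volume 0 τ :=
    hWi.continuousOn_mul (Real.continuous_exp.comp hΛc.neg).continuousOn
  have hsub : Icc 0 τ ⊆ Ici (0 : ℝ) := Icc_subset_Ici_self
  have hφ : ContinuousOn (fun t => ‖z t - y t‖) (Icc 0 τ) :=
    ((hz.1.mono hsub).sub (hy.1.mono hsub)).norm
  -- The value a(t, y, u₀) is inserted in between: the Lipschitz condition handles the change of
  -- state, and the deviation over the ball containing y(t) handles the change of control.
  have hpt : ∀ᵐ t, 0 ≤ t → t ∈ Icc 0 τ →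
      ‖a t (z t) (u₀ t) - ∫ u in U t, a t (y t) u ∂(η t : Measure V)‖ ≤
        L t * ‖z t - y t‖ + Real.exp (-Λ t) * W t := by
    filter_upwards [(ae_restrict_iff' measurableSet_Ici).1 hη.2] with t ht1 ht htτ
    have hint : IntegrableOn (fun u => a t (y t) u) (U t) (η t : Measure V) :=
      (ha.caratheodory.continuousOn_control ht _).integrableOn_compact (hU.isCompact t ht)
    have hwint : IntegrableOn (deviationWeight U a u₀ ρ L t) (U t) (η t : Measure V) :=
      (continuousOn_deviationWeight ha.caratheodory hu₀ ht).integrableOn_compact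
        (hU.isCompact t ht)
    -- Full mass on U(t) allows the value at u₀ to be moved under the mean.
    have hconst : ∫ _ in U t, a t (y t) (u₀ t) ∂(η t : Measure V) = a t (y t) (u₀ t) := by
      rw [setIntegral_const, measureReal_def, ht1 ht]
      simp
    have h1 : ‖a t (y t) (u₀ t) - ∫ u in U t, a t (y t) u ∂(η t : Measure V)‖ ≤
        Real.exp (-Λ t) * W t := by
      rw [← hconst, ← integral_sub (integrable_const _) hint, hW, ← integral_const_mul]
      refine norm_integral_le_of_norm_le (hwint.const_mul _)
        (ae_restrict_of_forall_mem (hUm t ht) fun u hu => ?_)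
      rw [norm_sub_rev]
      refine (norm_sub_le_deviation ha.caratheodory hu₀ ht hu (hyρ t htτ)).trans ?_
      rw [Real.exp_neg, le_inv_mul_iff₀ (Real.exp_pos _)]
      exact exp_mul_deviation_le_deviationWeight hu
    exact (norm_sub_le_norm_sub_add_norm_sub _ (a t (y t) (u₀ t)) _).trans
      (add_le_add (hLip t ht _ _) h1)
  have h1 := le_integral_exp_mul_of_le_integral hτ hL hL0 hφ hhi ?_
  · refine h1.trans (le_of_eq (intervalIntegral.integral_congr fun t _ => ?_))
    change Real.exp (Λ t) * (Real.exp (-Λ t) * W t) = W t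
    rw [← mul_assoc, ← Real.exp_add]
    simp
  · intro t ht
    have hsub' : uIcc t τ ⊆ uIcc 0 τ := by
      rw [uIcc_of_le ht.2, uIcc_of_le hτ]
      exact Icc_subset_Icc_left ht.1
    have h2 : y t - z t = ∫ s in t..τ, (a s (z s) (u₀ s) -
        ∫ u in U s, a s (y s) u ∂(η s : Measure V)) := by
      rw [intervalIntegral.integral_sub (hz.intervalIntegrable ht.1 hτ)
        (IsSolution.intervalIntegrable hy ht.1 hτ), ← hz.sub_eq_integral ht.1 hτ,
        ← IsSolution.sub_eq_integral hy ht.1 hτ, hzy]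
      abel
    rw [norm_sub_rev, h2]
    refine intervalIntegral.norm_integral_le_of_norm_le ht.2 ?_ ?_
    · filter_upwards [hpt] with s hs hst
      exact hs (ht.1.trans hst.1.le) ⟨ht.1.trans hst.1.le, hst.2⟩
    · exact (hL.intervalIntegrable.mul_continuousOn
        (hφ.mono (by rw [← uIcc_of_le hτ]; exact hsub'))).add (hhi.mono_set hsub')

end NullWeight

/-! ### The radius function and conclusion. -/

/-- A set-valued map that is bounded on compact time intervals lies in balls whose radius is a
measurable and locally bounded function of time. -/
theorem exists_measurable_radius {E : Type*} [NormedAddCommGroup E] {G : ℝ → Set E}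
    (hG : ∀ K : Set ℝ, IsCompact K → K ⊆ Ici 0 → Bornology.IsBounded (⋃ t ∈ K, G t)) :
    ∃ ρ : ℝ → ℝ, Measurable ρ ∧ (∀ N : ℝ, ∃ R, ∀ t ∈ Icc 0 N, |ρ t| ≤ R) ∧
      ∀ t, 0 ≤ t → ∀ x ∈ G t, ‖x‖ ≤ ρ t := by
  have h : ∀ n : ℕ, ∃ C, ∀ x ∈ ⋃ t ∈ Icc (0 : ℝ) n, G t, ‖x‖ ≤ C := fun n =>
    (hG (Icc 0 n) isCompact_Icc Icc_subset_Ici_self).exists_norm_le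
  choose R hR using h
  -- The radius is a step function using a bound for G on [0, ⌈t⌉]; on [0, N] only the finitely many
  -- indices up to ⌈N⌉ occur, and the sum of their absolute values bounds it.
  refine ⟨fun t => R ⌈t⌉₊, (measurable_of_countable R).comp Nat.measurable_ceil, fun N => ?_,
    fun t ht x hx => ?_⟩
  · refine ⟨∑ n ∈ Finset.range (⌈N⌉₊ + 1), |R n|, fun t ht => ?_⟩
    exact Finset.single_le_sum (f := fun n => |R n|) (fun _ _ => abs_nonneg _)
      (Finset.mem_range.2 (Nat.lt_succ_of_le (Nat.ceil_le_ceil ht.2)))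
  · exact hR _ x (mem_biUnion (show t ∈ Icc (0 : ℝ) ⌈t⌉₊ from ⟨ht, Nat.le_ceil t⟩) hx)

theorem proposition3
    {V : Type*} [NormedAddCommGroup V] [InnerProductSpace ℝ V] [FiniteDimensional ℝ V]
    [MeasurableSpace V] [BorelSpace V]
    {E : Type*} [NormedAddCommGroup E] [InnerProductSpace ℝ E] [FiniteDimensional ℝ E]
    [MeasurableSpace E] [BorelSpace E]
    (U : ℝ → Set V) (hU : ConditionU U)
    (a : ℝ → E → V → E) (ha : ConditionA U a)
    (u₀ : ℝ → V) (hu₀ : IsAdmissibleControl U u₀)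
    (G : ℝ → Set E) (hGcompact : ∀ t, 0 ≤ t → IsCompact (G t))
    (hGbounded : ∀ K : Set ℝ, IsCompact K → K ⊆ Ici 0 → Bornology.IsBounded (⋃ t ∈ K, G t))
    (hGclosed : IsClosed (timeGraph G)) :
    -- the initial value of the solution through a position is well defined
    (∀ τ, 0 ≤ τ → ∀ x : E, ∃ y, IsSolutionThrough a u₀ τ x y ∧
      ∀ z, IsSolutionThrough a u₀ τ x z → EqOn z y (Ici 0)) ∧
    ∃ w : ℝ → V → ℝ, IsNullWeight U u₀ w ∧
      ∀ η : ℝ → ProbabilityMeasure V, IsRelaxedControl U η →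
      ∀ T : ℝ, 0 ≤ T → ∀ y : ℝ → E, IsTrajectory U a η y →
      (∀ t ∈ Icc 0 T, y t ∈ G t) →
      ∀ τ ∈ Icc 0 T, ‖begPoint a u₀ τ (y τ) - y 0‖ ≤ weightIntegral U w η τ := by
  have hV : ProperSpace V := FiniteDimensional.proper ℝ V
  have hE : ProperSpace E := FiniteDimensional.proper ℝ E
  have hex : ∀ τ, 0 ≤ τ → ∀ x : E, ∃ y, IsSolutionThrough a u₀ τ x y ∧
      ∀ z, IsSolutionThrough a u₀ τ x z → EqOn z y (Ici 0) :=
    fun τ hτ x => ha.exists_unique_solutionThrough hu₀ hτ x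
  obtain ⟨L, hL, hLip⟩ := ha.continuable.2
  obtain ⟨ρ, hρm, hρ, hGρ⟩ := exists_measurable_radius hGbounded
  have hLi : LocallyIntegrable ((Ici (0 : ℝ)).indicator L) volume :=
    hL.2.locallyIntegrable_indicator
  have hL0 : ∀ t, 0 ≤ (Ici (0 : ℝ)).indicator L t := indicator_nonneg fun t ht => hL.1 t ht
  have hLip0 : ∀ t, 0 ≤ t → ∀ x x',
      ‖a t x (u₀ t) - a t x' (u₀ t)‖ ≤ (Ici (0 : ℝ)).indicator L t * ‖x - x'‖ := by
    intro t ht x x'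
    rw [indicator_of_mem (show t ∈ Ici (0 : ℝ) from ht)]
    exact hLip t ht x x' _ (hu₀.2 t ht)
  refine ⟨hex, deviationWeight U a u₀ ρ ((Ici (0 : ℝ)).indicator L),
    isNullWeight_deviationWeight hU ha hu₀ hLi hL0 hρm hρ, ?_⟩
  intro η hη T _ y hy hyG τ hτ
  have h : ∃ z, IsSolutionThrough a u₀ τ (y τ) z :=
    (hex τ hτ.1 (y τ)).imp fun _ h => h.1
  -- The estimate holds for any solution through (τ, y(τ)), in particular for the chosen one; the
  -- default value 0 never enters.
  rw [begPoint, dif_pos h]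
  exact norm_sub_le_weightIntegral hU ha hu₀ hLi hL0 hLip0 hρm hρ hη hy h.choose_spec.1 hτ.1
    h.choose_spec.2 fun t ht => hGρ t ht.1 _ (hyG t ⟨ht.1, ht.2.trans hτ.2⟩)
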